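/- **Theorem (Nondegeneracy).** Let $n\ge 1$ and $\Lambda>0$. There is a constant $C=C(n,\Lambda)>0$ such that the following holds. Let $B_1=B_1(0)\subset\mathbb R^n$ be the open unit ball, and let $\mathcal A=(a^{ij})$ be a measurable symmetric $n\times n$ matrix function on $B_1$ which satisfies, for some $\lambda>0$ and almost every $x\in B_1$, $$\lambda|\xi|^2\le \sum_{i,j} a^{ij}(x)\,\xi_i\xi_j\le\Lambda|\xi|^2\qquad\text{for all }\xi\in\mathbb R^n .$$ (No other regularity of $a^{ij}$ is assumed, and $C$ does not depend on $\lambda$.) Let $w\in W^{2,n}_{\mathrm{loc}}(B_1)\cap C^0(B_1)$, $w\ge 0$, be a strong solution of $$\sum_{i,j}a^{ij}D_{ij}w=\chi_{\{w>0\}}\quad\text{in } B_1,$$ that is, the equation holds almost everywhere in $B_1$, with $D_{ij}w$ the weak second derivatives of $w$. If $r>0$, $B_r(x_0)\subset B_1$ and $x_0$ lies in the closure of $\{x\in B_1 : w(x)>0\}$, then $$\sup_{x\in B_r(x_0)}w(x)\ \ge\ C\,r^2 ,$$ where the supremum may be $+\infty$. -/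

import Mathlib

open MeasureTheory
open scoped ENNReal ContDiff

namespace ObstacleProblem

/-- `g` is the weak partial derivative of `u` in the `i`-th coordinate direction on the open
set `U`: both are locally integrable on `U`, and `∫_U u ∂ᵢφ = - ∫_U g φ` for every smooth test
function `φ` with compact support contained in `U`. -/
def IsWeakPartial {n : ℕ} (U : Set (EuclideanSpace ℝ (Fin n))) (i : Fin n)
    (u g : EuclideanSpace ℝ (Fin n) → ℝ) : Prop :=
  LocallyIntegrableOn u U ∧ LocallyIntegrableOn g U ∧
    ∀ φ : EuclideanSpace ℝ (Fin n) → ℝ, ContDiff ℝ ∞ φ → HasCompactSupport φ → tsupport φ ⊆ U →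
      ∫ x in U, u x * fderiv ℝ φ x (EuclideanSpace.single i 1) = - ∫ x in U, g x * φ x

/-- `u ∈ L^p_loc(U)`: `u` is in `L^p` of every compact subset of `U`. -/
def MemLpLoc {n : ℕ} (p : ℝ≥0∞) (U : Set (EuclideanSpace ℝ (Fin n)))
    (u : EuclideanSpace ℝ (Fin n) → ℝ) : Prop :=
  ∀ K : Set (EuclideanSpace ℝ (Fin n)), IsCompact K → K ⊆ U → MemLp u p (volume.restrict K)

/-- `u ∈ W^{2,p}_loc(U)`, with weak gradient `Du` and matrix of weak second derivatives `D2u`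
(both unique up to null sets); `D2u x i j` is `D_{ij} u (x)`. -/
structure IsSobolevTwoLoc {n : ℕ} (p : ℝ≥0∞) (U : Set (EuclideanSpace ℝ (Fin n)))
    (u : EuclideanSpace ℝ (Fin n) → ℝ)
    (Du : EuclideanSpace ℝ (Fin n) → Fin n → ℝ)
    (D2u : EuclideanSpace ℝ (Fin n) → Matrix (Fin n) (Fin n) ℝ) : Prop where
  memLpLoc : MemLpLoc p U u
  memLpLoc_grad : ∀ i, MemLpLoc p U (fun x => Du x i)
  memLpLoc_hess : ∀ i j, MemLpLoc p U (fun x => D2u x i j)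
  weak_grad : ∀ i, IsWeakPartial U i u (fun x => Du x i)
  weak_hess : ∀ i j, IsWeakPartial U j (fun x => Du x i) (fun x => D2u x i j)

/-- The coefficient matrix `a` is measurable, symmetric and uniformly elliptic on `U`, i.e.
`lam I ≤ a(x) ≤ Lam I` for almost every `x ∈ U`, where `lam > 0`. -/
structure IsUniformlyElliptic {n : ℕ} (lam Lam : ℝ) (U : Set (EuclideanSpace ℝ (Fin n)))
    (a : EuclideanSpace ℝ (Fin n) → Matrix (Fin n) (Fin n) ℝ) : Prop where
  lam_pos : 0 < lam
  aemeasurable : ∀ i j, AEMeasurable (fun x => a x i j) (volume.restrict U)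
  symm : ∀ᵐ x ∂(volume.restrict U), (a x).IsSymm
  elliptic : ∀ᵐ x ∂(volume.restrict U), ∀ ξ : EuclideanSpace ℝ (Fin n),
    lam * ‖ξ‖ ^ 2 ≤ ∑ i, ∑ j, a x i j * ξ i * ξ j ∧
      ∑ i, ∑ j, a x i j * ξ i * ξ j ≤ Lam * ‖ξ‖ ^ 2

/-- The set `{w > 0}` inside the unit ball. -/
def positivitySet {n : ℕ} (w : EuclideanSpace ℝ (Fin n) → ℝ) : Set (EuclideanSpace ℝ (Fin n)) :=
  {x | x ∈ Metric.ball 0 1 ∧ 0 < w x}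

/-- `w` is a nonnegative continuous strong solution, of class `W^{2,n}_loc`, of the obstacle
problem `a^{ij} D_{ij} w = χ_{w > 0}` in the open unit ball of `ℝⁿ`: the equation holds almost
everywhere, the `D_{ij} w` being the weak second derivatives of `w`. -/
structure IsStrongSolution {n : ℕ} (a : EuclideanSpace ℝ (Fin n) → Matrix (Fin n) (Fin n) ℝ)
    (w : EuclideanSpace ℝ (Fin n) → ℝ) : Prop where
  continuousOn : ContinuousOn w (Metric.ball 0 1)
  nonneg : ∀ x ∈ Metric.ball (0 : EuclideanSpace ℝ (Fin n)) 1, 0 ≤ w x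
  equation : ∃ Dw D2w, IsSobolevTwoLoc (n : ℝ≥0∞) (Metric.ball 0 1) w Dw D2w ∧
    ∀ᵐ x ∂(volume.restrict (Metric.ball (0 : EuclideanSpace ℝ (Fin n)) 1)),
      ∑ i, ∑ j, a x i j * D2w x i j = (positivitySet w).indicator (fun _ => (1 : ℝ)) x

end ObstacleProblem

/-! The classical argument compares `w` with a paraboloid. Take `x₁` near `x₀` with `w x₁ > 0`, and
let `y` maximise `w - c|x - x₁|²` over the closed ball of radius `r/2` about `x₁`. The maximum is at
least `w x₁ > 0`, so `w y > 0`. If `w` were below `c r²/4` throughout `B_r(x₀)`, the function would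
be negative on the boundary sphere, so `y` would be interior. Near `y` the equation reads `a^{ij}
D_{ij} w = 1`. Subtracting also `c|x - y|²` makes the maximum strict, while for `c = 1/(4nΛ)` the
two paraboloids together satisfy `a^{ij} D_{ij} q = 4c tr a ≤ 1`. Thus `w - q` is a subsolution with
a strict interior maximum, which the maximum principle forbids.

As `w` is only in `W^{2,n}_loc`, this is Bony's maximum principle
(`exists_sphere_lt_of_subsolution`), obtained from an Aleksandrov-Bakelman-Pucci argument. For a
`C²` function whose central value exceeds its values on a sphere by a fixed gap, the gradients at
points of concavity fill a ball of fixed radius, so the integral of `|det D²|` over those points is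
bounded below (`volume_ball_le_lintegral_det_hessian`). For mollifications of `u`, minus `q`,
ellipticity bounds this determinant by the `n`-th power of the error in the second derivatives
(`abs_det_le_of_elliptic`), whose integral tends to zero.

The lower bound `λ` enters only the factor `Λ/λ` of a quantity that tends to zero; hence `C` does
not depend on it. -/

namespace ObstacleProblem

/-! ### Linear algebra of semidefinite and elliptic matrices -/

/-- The determinant of a positive semidefinite matrix is at most the power of its trace. -/
theorem det_le_trace_pow {n : ℕ} {P : Matrix (Fin n) (Fin n) ℝ} (hP : P.PosSemidef) :
    P.det ≤ P.trace ^ n := by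
  rw [hP.isHermitian.det_eq_prod_eigenvalues, hP.isHermitian.trace_eq_sum_eigenvalues]
  simp only [RCLike.ofReal_real_eq_id, id_eq]
  calc ∏ i, hP.isHermitian.eigenvalues i
      ≤ ∏ _i : Fin n, ∑ j, hP.isHermitian.eigenvalues j :=
        Finset.prod_le_prod (fun i _ => hP.eigenvalues_nonneg i) fun i _ =>
          Finset.single_le_sum (fun j _ => hP.eigenvalues_nonneg j) (Finset.mem_univ i)
    _ = _ := by simp

/-- The product of two positive semidefinite matrices has nonnegative trace. -/
theorem trace_mul_nonneg {n : ℕ} {P Q : Matrix (Fin n) (Fin n) ℝ} (hP : P.PosSemidef)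
    (hQ : Q.PosSemidef) : 0 ≤ (P * Q).trace := by
  classical
  open scoped MatrixOrder in
  -- With `Q = Bᴴ B`, cyclicity gives `tr (P Q) = tr (B P Bᴴ)`, the trace of a positive semidefinite
  -- matrix.
  obtain ⟨B, rfl⟩ := CStarAlgebra.nonneg_iff_eq_star_mul_self.mp hQ.nonneg
  rw [Matrix.star_eq_conjTranspose, ← Matrix.mul_assoc, Matrix.trace_mul_comm, ← Matrix.mul_assoc]
  exact (hP.mul_mul_conjTranspose_same B).trace_nonneg

theorem posSemidef_of_forall_sum {n : ℕ} {P : Matrix (Fin n) (Fin n) ℝ} (hs : P.IsSymm)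
    (h : ∀ ξ : EuclideanSpace ℝ (Fin n), 0 ≤ ∑ i, ∑ j, P i j * ξ i * ξ j) : P.PosSemidef := by
  refine Matrix.PosSemidef.of_dotProduct_mulVec_nonneg ?_ fun x => ?_
  · rw [Matrix.IsHermitian, Matrix.conjTranspose_eq_transpose_of_trivial]; exact hs
  · have := h (WithLp.toLp 2 x)
    simp only [dotProduct, Matrix.mulVec, Finset.mul_sum, Pi.star_apply, star_trivial]
    refine this.trans_eq (Finset.sum_congr rfl fun i _ => Finset.sum_congr rfl fun j _ => ?_)
    simp only []
    ring

/-- A negative semidefinite matrix which is almost a subsolution for elliptic coefficients has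
small determinant. -/
theorem abs_det_le_of_elliptic {n : ℕ} {a M : Matrix (Fin n) (Fin n) ℝ} {lam g : ℝ}
    (hlam : 0 < lam) (ha : a.IsSymm)
    (hell : ∀ ξ : EuclideanSpace ℝ (Fin n), lam * ‖ξ‖ ^ 2 ≤ ∑ i, ∑ j, a i j * ξ i * ξ j)
    (hM : M.IsSymm) (hneg : ∀ ξ : EuclideanSpace ℝ (Fin n), ∑ i, ∑ j, M i j * ξ i * ξ j ≤ 0)
    (hg : 0 ≤ ∑ i, ∑ j, a i j * M i j + g) : |M.det| ≤ (g / lam) ^ n := by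
  have hP : (-M).PosSemidef := by
    refine posSemidef_of_forall_sum hM.neg fun ξ => ?_
    have := hneg ξ
    simp only [Matrix.neg_apply, neg_mul, Finset.sum_neg_distrib]
    linarith
  have hQ : (a - lam • (1 : Matrix (Fin n) (Fin n) ℝ)).PosSemidef := by
    refine posSemidef_of_forall_sum (ha.sub (Matrix.isSymm_one.smul lam)) fun ξ => ?_
    have := hell ξ
    simp only [Matrix.sub_apply, sub_mul, Finset.sum_sub_distrib, Matrix.smul_apply,
      Matrix.one_apply, smul_eq_mul, mul_ite, mul_one, mul_zero, ite_mul, zero_mul,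
      Finset.sum_ite_eq, Finset.mem_univ, if_true]
    rw [EuclideanSpace.norm_sq_eq, Finset.mul_sum] at this
    simp only [Real.norm_eq_abs, sq_abs] at this
    have h2 : ∑ x, lam * ξ.ofLp x * ξ.ofLp x = ∑ i, lam * ξ.ofLp i ^ 2 :=
      Finset.sum_congr rfl fun i _ => by ring
    rw [h2]; linarith
  -- Since `a - lam I` and `-M` are both positive semidefinite, `lam tr(-M) ≤ -tr(a M) ≤ g`.
  have htr := trace_mul_nonneg hQ hP
  have h1 : (a * -M).trace = - ∑ i, ∑ j, a i j * M i j := by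
    simp only [Matrix.trace, Matrix.diag, Matrix.mul_apply, Matrix.neg_apply, mul_neg,
      Finset.sum_neg_distrib]
    congr 1
    exact Finset.sum_congr rfl fun i _ => Finset.sum_congr rfl fun j _ => by rw [hM.apply]
  rw [Matrix.sub_mul, Matrix.trace_sub, h1, Matrix.smul_mul, Matrix.trace_smul, Matrix.one_mul,
    smul_eq_mul] at htr
  have h2 : |M.det| = (-M).det := by
    rw [← abs_of_nonneg hP.det_nonneg, Matrix.det_neg, abs_mul]
    simp
  rw [h2]
  refine (det_le_trace_pow hP).trans (pow_le_pow_left₀ hP.trace_nonneg ?_ n)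
  rw [le_div_iff₀ hlam]
  linarith

theorem sum_single_quadratic {n : ℕ} (a : Matrix (Fin n) (Fin n) ℝ) (i : Fin n) :
    ∑ k, ∑ l, a k l * (EuclideanSpace.single i (1 : ℝ)) k * (EuclideanSpace.single i (1 : ℝ)) l
      = a i i := by
  simp

/-- The entries of a symmetric matrix between `0` and `Lam` are bounded by `Lam`. -/
theorem abs_apply_le_of_elliptic {n : ℕ} {a : Matrix (Fin n) (Fin n) ℝ} {Lam : ℝ}
    (ha : a.IsSymm)
    (hell : ∀ ξ : EuclideanSpace ℝ (Fin n), 0 ≤ ∑ i, ∑ j, a i j * ξ i * ξ j ∧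
      ∑ i, ∑ j, a i j * ξ i * ξ j ≤ Lam * ‖ξ‖ ^ 2) (i j : Fin n) : |a i j| ≤ Lam := by
  by_cases hij : i = j
  · subst hij
    have := hell (EuclideanSpace.single i 1)
    rw [sum_single_quadratic] at this
    simp only [PiLp.norm_single, norm_one, one_pow, mul_one] at this
    rw [abs_of_nonneg this.1]; exact this.2
  -- Testing with `e_i + e_j` and `e_i - e_j` and subtracting the two estimates isolates the
  -- off-diagonal entry.
  · have key : ∀ s : ℝ, s ^ 2 = 1 → 0 ≤ a i i + a j j + 2 * s * a i j ∧
        a i i + a j j + 2 * s * a i j ≤ 2 * Lam := by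
      intro s hs
      have := hell (EuclideanSpace.single i 1 + EuclideanSpace.single j s)
      have hq : ∑ k, ∑ l, a k l
          * (EuclideanSpace.single i (1 : ℝ) + EuclideanSpace.single j s : EuclideanSpace ℝ _) k
          * (EuclideanSpace.single i (1 : ℝ) + EuclideanSpace.single j s : EuclideanSpace ℝ _) l
          = a i i + a j j + 2 * s * a i j := by
        have h1 := ha.apply i j
        simp [mul_add, add_mul, Finset.sum_add_distrib]
        rw [h1]; linear_combination a j j * hs
      have hn : ‖(EuclideanSpace.single i (1 : ℝ) + EuclideanSpace.single j s :
          EuclideanSpace ℝ (Fin n))‖ ^ 2 = 2 := by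
        rw [norm_add_sq_real]
        simp [hs, EuclideanSpace.inner_single_left, hij]; norm_num
      rw [hq, hn] at this
      exact ⟨this.1, by linarith [this.2]⟩
    have h1 := key 1 (by norm_num)
    have h2 := key (-1) (by norm_num)
    rw [abs_le]; constructor <;> linarith

/-! ### Maxima, the gradient map and the geometric ABP estimate -/

/-- The second derivative of a `C²` function is nonpositive at a local maximum. -/
theorem fderiv_fderiv_nonpos_of_isLocalMax {E : Type*} [NormedAddCommGroup E] [NormedSpace ℝ E]
    {u : E → ℝ} (hu : ContDiff ℝ 2 u) {z : E} (h : IsLocalMax u z) (ξ : E) :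
    fderiv ℝ (fderiv ℝ u) z ξ ξ ≤ 0 := by
  have hline : ∀ t : ℝ, HasDerivAt (fun t : ℝ => z + t • ξ) ξ t := fun t => by
    simpa using ((hasDerivAt_id t).smul_const ξ).const_add z
  have hd1 : ∀ t : ℝ, HasDerivAt (fun t : ℝ => u (z + t • ξ)) (fderiv ℝ u (z + t • ξ) ξ) t :=
    fun t => ((hu.differentiable two_ne_zero) _).hasFDerivAt.comp_hasDerivAt t (hline t)
  have hfd : Differentiable ℝ (fderiv ℝ u) :=
    (hu.fderiv_right (m := 1) (by norm_num)).differentiable one_ne_zero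
  have hd2 : HasDerivAt (fun t : ℝ => fderiv ℝ u (z + t • ξ) ξ)
      (fderiv ℝ (fderiv ℝ u) z ξ ξ) 0 := by
    have h1 : HasDerivAt (fun t : ℝ => fderiv ℝ u (z + t • ξ))
        (fderiv ℝ (fderiv ℝ u) (z + (0 : ℝ) • ξ) ξ) 0 :=
      (hfd _).hasFDerivAt.comp_hasDerivAt 0 (hline 0)
    simpa using h1.clm_apply (hasDerivAt_const (0 : ℝ) ξ)
  have hmax : IsLocalMax (fun t : ℝ => u (z + t • ξ)) 0 := by
    have hc : Filter.Tendsto (fun t : ℝ => z + t • ξ) (nhds 0) (nhds z) := by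
      simpa using (hline 0).continuousAt.tendsto
    have := hc.eventually h
    simpa [IsLocalMax, IsMaxFilter] using this
  have hdd : deriv (fun t : ℝ => u (z + t • ξ)) = fun t => fderiv ℝ u (z + t • ξ) ξ :=
    funext fun t => (hd1 t).deriv
  -- A positive second derivative would make `0` a local minimum as well, so the restriction to the
  -- line would be locally constant and its second derivative zero.
  by_contra! hpos
  have hmin : IsLocalMin (fun t : ℝ => u (z + t • ξ)) 0 := by
    refine isLocalMin_of_deriv_deriv_pos ?_ hmax.deriv_eq_zero (hd1 0).continuousAt
    rw [hdd, hd2.deriv]; exact hpos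
  have hconst : (fun t : ℝ => u (z + t • ξ)) =ᶠ[nhds 0] fun _ => u (z + (0 : ℝ) • ξ) := by
    filter_upwards [hmax, hmin] with t h1 h2 using le_antisymm h1 h2
  have h0 := hconst.deriv.deriv_eq
  rw [hdd, hd2.deriv] at h0
  simp at h0
  exact hpos.ne' h0

section Gradient

variable {n : ℕ}

/-- The vector representing a linear functional on Euclidean space. -/
noncomputable def dualVector (n : ℕ) :
    (EuclideanSpace ℝ (Fin n) →L[ℝ] ℝ) →L[ℝ] EuclideanSpace ℝ (Fin n) :=
  ((EuclideanSpace.equiv (Fin n) ℝ).symm : (Fin n → ℝ) →L[ℝ] EuclideanSpace ℝ (Fin n)).comp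
    (ContinuousLinearMap.pi fun i => ContinuousLinearMap.apply ℝ ℝ (EuclideanSpace.single i 1))

theorem dualVector_apply (L : EuclideanSpace ℝ (Fin n) →L[ℝ] ℝ) (i : Fin n) :
    dualVector n L i = L (EuclideanSpace.single i 1) := rfl

/-- The points of a ball at which the second derivative is negative semidefinite. -/
def concavitySet (u : EuclideanSpace ℝ (Fin n) → ℝ) (y : EuclideanSpace ℝ (Fin n)) (s : ℝ) : Set (EuclideanSpace ℝ (Fin n)) :=
  {z | z ∈ Metric.ball y s ∧ ∀ ξ, fderiv ℝ (fderiv ℝ u) z ξ ξ ≤ 0}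

/-- If `u` has a strict maximum at the centre of a ball relative to its boundary, then every small
slope is attained at a point where the second derivative is negative semidefinite. -/
theorem ball_subset_gradient_image {u : EuclideanSpace ℝ (Fin n) → ℝ} (hu : ContDiff ℝ 2 u) {y : EuclideanSpace ℝ (Fin n)} {s δ : ℝ}
    (hs : 0 < s) (hbd : ∀ x ∈ Metric.sphere y s, u x + δ * s ≤ u y) :
    Metric.ball 0 δ ⊆ (fun z => dualVector n (fderiv ℝ u z)) ''
      concavitySet u y s := by
  intro p hp
  rw [mem_ball_zero_iff] at hp
  -- Tilting by the slope `p`: on the sphere the linear term changes `u` by at most `‖p‖ s < δ s`,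
  -- less than the gap, so the maximum of `h` is interior, and there the gradient of `u` is `p`.
  set h : EuclideanSpace ℝ (Fin n) → ℝ := fun x => u x - inner ℝ p (x - y) with hh
  have hh2 : ContDiff ℝ 2 h := hu.sub (contDiff_const.inner ℝ (contDiff_id.sub contDiff_const))
  obtain ⟨z, hz, hzmax⟩ := (isCompact_closedBall y s).exists_isMaxOn
    ⟨y, Metric.mem_closedBall_self hs.le⟩ hh2.continuous.continuousOn
  have hzb : z ∈ Metric.ball y s := by
    rw [← Metric.ball_union_sphere] at hz
    refine hz.resolve_right fun hsph => ?_
    have h1 : h y ≤ h z := hzmax (Metric.mem_closedBall_self hs.le)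
    have h2 := hbd z hsph
    have h3 : -(‖p‖ * s) ≤ inner ℝ p (z - y) := by
      have := abs_real_inner_le_norm p (z - y)
      rw [← dist_eq_norm, Metric.mem_sphere.1 hsph] at this
      exact (abs_le.1 this).1
    have h4 : ‖p‖ * s < δ * s := mul_lt_mul_of_pos_right hp hs
    simp only [hh, sub_self, inner_zero_right] at h1
    linarith
  have hmax : IsLocalMax h z := hzmax.isLocalMax
    (Filter.mem_of_superset (Metric.isOpen_ball.mem_nhds hzb) Metric.ball_subset_closedBall)
  have hfd : fderiv ℝ h = fun x => fderiv ℝ u x - innerSL ℝ p := by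
    funext x
    have h1 : HasFDerivAt (fun x => inner ℝ p (x - y)) (innerSL ℝ p) x := by
      simpa [Function.comp_def] using
        (innerSL ℝ p).hasFDerivAt.comp x ((hasFDerivAt_id x).sub_const y)
    exact (((hu.differentiable two_ne_zero) x).hasFDerivAt.sub h1).fderiv
  refine ⟨z, ⟨hzb, fun ξ => ?_⟩, ?_⟩
  · have := fderiv_fderiv_nonpos_of_isLocalMax hh2 hmax ξ
    rwa [hfd, fderiv_sub_const] at this
  · have := hmax.fderiv_eq_zero
    rw [hfd] at this
    ext i
    rw [dualVector_apply, sub_eq_zero.1 this]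
    simp [EuclideanSpace.inner_single_right]

/-- The area formula requires a measurable domain; concavity is a closed condition because the
second derivative is continuous. -/
theorem measurableSet_concavitySet {u : EuclideanSpace ℝ (Fin n) → ℝ}
    (hu : ContDiff ℝ 2 u) (y : EuclideanSpace ℝ (Fin n)) (s : ℝ) : MeasurableSet (concavitySet u y s) := by
  refine measurableSet_ball.inter (IsClosed.measurableSet ?_)
  have hc : Continuous (fderiv ℝ (fderiv ℝ u)) :=
    (hu.fderiv_right (m := 1) (by norm_num)).continuous_fderiv one_ne_zero
  have he : {z | ∀ ξ, fderiv ℝ (fderiv ℝ u) z ξ ξ ≤ 0} =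
      ⋂ ξ, {z | fderiv ℝ (fderiv ℝ u) z ξ ξ ≤ 0} := by ext z; simp
  change IsClosed {z | ∀ ξ, fderiv ℝ (fderiv ℝ u) z ξ ξ ≤ 0}
  rw [he]
  exact isClosed_iInter fun ξ => isClosed_le ((hc.clm_apply continuous_const).clm_apply
    continuous_const) continuous_const

end Gradient

/-- The matrix of second derivatives. -/
noncomputable def hessian {n : ℕ} (u : EuclideanSpace ℝ (Fin n) → ℝ)
    (x : EuclideanSpace ℝ (Fin n)) : Matrix (Fin n) (Fin n) ℝ := fun i j =>
  -- The outer derivative is in direction `j`, matching `weak_hess`, where `D2u x i j` is the `j`-th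
  -- derivative of `Du x i`.
  fderiv ℝ (fderiv ℝ u) x (EuclideanSpace.single j 1) (EuclideanSpace.single i 1)

theorem hessian_isSymm {n : ℕ} {u : EuclideanSpace ℝ (Fin n) → ℝ} (hu : ContDiff ℝ 2 u)
    (x : EuclideanSpace ℝ (Fin n)) : (hessian u x).IsSymm := by
  refine Matrix.IsSymm.ext fun i j => ?_
  exact (hu.contDiffAt.isSymmSndFDerivAt (by simp)).eq _ _

/-- Translates the condition defining `concavitySet` into the matrix form used in the determinant
bound. -/
theorem sum_hessian {n : ℕ} (u : EuclideanSpace ℝ (Fin n) → ℝ)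
    (x ξ : EuclideanSpace ℝ (Fin n)) :
    ∑ i, ∑ j, hessian u x i j * ξ i * ξ j = fderiv ℝ (fderiv ℝ u) x ξ ξ := by
  have hξ : ξ = ∑ i, ξ i • EuclideanSpace.single i (1 : ℝ) := by
    simpa using ((EuclideanSpace.basisFun (Fin n) ℝ).sum_repr ξ).symm
  conv_rhs => rw [hξ]
  simp only [map_sum, map_smul, sum_apply, smul_apply,
    smul_eq_mul, Finset.mul_sum, hessian]
  exact Finset.sum_congr rfl fun i _ => Finset.sum_congr rfl fun j _ => by ring

/-- The derivative of the gradient map has the determinant of the Hessian matrix. -/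
theorem det_dualVector_comp {n : ℕ} (u : EuclideanSpace ℝ (Fin n) → ℝ)
    (x : EuclideanSpace ℝ (Fin n)) :
    ((dualVector n).comp (fderiv ℝ (fderiv ℝ u) x)).det
      = (hessian u x).det := by
  rw [ContinuousLinearMap.det, ← LinearMap.det_toMatrix
    (EuclideanSpace.basisFun (Fin n) ℝ).toBasis]
  congr 1

/-- The Aleksandrov-Bakelman-Pucci estimate in its geometric form. -/
theorem volume_ball_le_lintegral_det_hessian {n : ℕ} {u : EuclideanSpace ℝ (Fin n) → ℝ}
    (hu : ContDiff ℝ 2 u) {y : EuclideanSpace ℝ (Fin n)} {s δ : ℝ} (hs : 0 < s)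
    (hbd : ∀ x ∈ Metric.sphere y s, u x + δ * s ≤ u y) :
    volume (Metric.ball (0 : EuclideanSpace ℝ (Fin n)) δ) ≤
      ∫⁻ z in concavitySet u y s, ENNReal.ofReal |(hessian u z).det| := by
  refine (measure_mono (ball_subset_gradient_image hu hs hbd)).trans ?_
  simp_rw [← det_dualVector_comp]
  refine addHaar_image_le_lintegral_abs_det_fderiv volume (measurableSet_concavitySet hu y s)
    fun x _ => ?_
  have hfd : Differentiable ℝ (fderiv ℝ u) :=
    (hu.fderiv_right (m := 1) (by norm_num)).differentiable one_ne_zero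
  exact ((dualVector n).hasFDerivAt.comp x (hfd x).hasFDerivAt).hasFDerivWithinAt

/-! ### Mollification in `L^p` and in `W^{2,p}_loc` -/

open scoped Convolution Topology
open ContinuousLinearMap (lsmul)

section Mollification

variable {E : Type*} [NormedAddCommGroup E] [InnerProductSpace ℝ E] [FiniteDimensional ℝ E]
  [MeasurableSpace E] [BorelSpace E]

/-- Mollification does not increase the `L^p` norm. -/
theorem eLpNorm_normed_convolution_le (φ : ContDiffBump (0 : E)) {f : E → ℝ} {p : ℝ≥0∞}
    (hp : 1 ≤ p) (hp' : p ≠ ⊤) (hf : AEStronglyMeasurable f) :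
    eLpNorm (φ.normed volume ⋆[lsmul ℝ ℝ, volume] f) p volume ≤ eLpNorm f p volume := by
  -- The mollifier is the density of a probability measure, so the convolution is an average of
  -- translates of `f`: Jensen's inequality bounds it pointwise by an `L^p(ν)` norm, and Tonelli
  -- with translation invariance finishes.
  set ν : Measure E := volume.withDensity fun t => ENNReal.ofReal (φ.normed volume t) with hν
  have hρm : Measurable fun t => ENNReal.ofReal (φ.normed volume t) :=
    φ.continuous_normed.measurable.ennreal_ofReal
  have hνac : ν ≪ volume := withDensity_absolutelyContinuous _ _
  have hprob : IsProbabilityMeasure ν := by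
    refine ⟨?_⟩
    rw [hν, withDensity_apply _ MeasurableSet.univ, Measure.restrict_univ,
      ← ofReal_integral_eq_lintegral_ofReal φ.integrable_normed
        (Filter.Eventually.of_forall φ.nonneg_normed), φ.integral_normed, ENNReal.ofReal_one]
  have hp0 : p ≠ 0 := (zero_lt_one.trans_le hp).ne'
  have hfx : ∀ x, AEStronglyMeasurable (fun t => f (x - t)) ν := fun x =>
    (hf.comp_quasiMeasurePreserving
      (quasiMeasurePreserving_sub_left volume x)).mono_ac hνac
  have hpt : ∀ x, ‖(φ.normed volume ⋆[lsmul ℝ ℝ, volume] f) x‖ₑ ≤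
      eLpNorm (fun t => f (x - t)) p ν := by
    intro x
    refine le_trans ?_ (eLpNorm_le_eLpNorm_of_exponent_le hp (hfx x))
    rw [eLpNorm_one_eq_lintegral_enorm, hν,
      lintegral_withDensity_eq_lintegral_mul₀' hρm.aemeasurable (hfx x).enorm]
    refine (enorm_integral_le_lintegral_enorm _).trans (lintegral_mono fun t => ?_)
    simp only [ContinuousLinearMap.lsmul_apply, smul_eq_mul, enorm_mul, Pi.mul_apply]
    rw [Real.enorm_of_nonneg (φ.nonneg_normed t)]
  rw [eLpNorm_eq_lintegral_rpow_enorm_toReal hp0 hp', eLpNorm_eq_lintegral_rpow_enorm_toReal hp0 hp']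
  refine ENNReal.rpow_le_rpow ?_ (by positivity)
  have hr : 0 < p.toReal := ENNReal.toReal_pos hp0 hp'
  calc ∫⁻ x, ‖(φ.normed volume ⋆[lsmul ℝ ℝ, volume] f) x‖ₑ ^ p.toReal
      ≤ ∫⁻ x, ∫⁻ t, ‖f (x - t)‖ₑ ^ p.toReal ∂ν := by
        refine lintegral_mono fun x => ?_
        refine (ENNReal.rpow_le_rpow (hpt x) hr.le).trans_eq ?_
        rw [eLpNorm_eq_lintegral_rpow_enorm_toReal hp0 hp', ← ENNReal.rpow_mul, one_div,
          inv_mul_cancel₀ hr.ne', ENNReal.rpow_one]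
    _ = ∫⁻ t, (∫⁻ x, ‖f (x - t)‖ₑ ^ p.toReal) ∂ν := by
        refine lintegral_lintegral_swap (μ := volume) (ν := ν)
          (f := fun x t => ‖f (x - t)‖ₑ ^ p.toReal) ?_
        exact ((hf.comp_quasiMeasurePreserving
          (quasiMeasurePreserving_sub_of_right_invariant volume ν)).enorm.pow_const _)
    _ = ∫⁻ x, ‖f x‖ₑ ^ p.toReal := by
        have hinv : ∀ t, ∫⁻ x, ‖f (x - t)‖ₑ ^ p.toReal = ∫⁻ x, ‖f x‖ₑ ^ p.toReal := fun t =>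
          lintegral_sub_right_eq_self (fun x => ‖f x‖ₑ ^ p.toReal) t
        simp [hinv]

/-- Mollifications converge in `L^p` on sets of finite measure. -/
theorem eventually_eLpNorm_normed_convolution_sub_le {f : E → ℝ} {p : ℝ≥0∞}
    (hp : 1 ≤ p) (hp' : p ≠ ⊤) (hf : MemLp f p volume) {K : Set E} (hK : volume K ≠ ⊤)
    {ε : ℝ≥0∞} (hε : ε ≠ 0) :
    ∀ᶠ δ in 𝓝[>] (0 : ℝ), ∀ φ : ContDiffBump (0 : E), φ.rOut = δ →
      eLpNorm (fun x => (φ.normed volume ⋆[lsmul ℝ ℝ, volume] f) x - f x) p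
        (volume.restrict K) ≤ ε := by
  have hε3 : ε / 3 ≠ 0 := by simp [hε]
  obtain ⟨h, hsupp, hfh, hcont, hmem⟩ := hf.exists_hasCompactSupport_eLpNorm_sub_le hp' hε3
  have hA : volume K ^ p.toReal⁻¹ ≠ ⊤ := ENNReal.rpow_ne_top_of_nonneg (by positivity) hK
  -- A uniform error `η` costs at most `η · volume(K)^{1/p} < ε/3` in `L^p(K)`; uniform continuity
  -- of `h` supplies it at small radii.
  obtain ⟨η, hη, hηA⟩ := ENNReal.exists_nnreal_pos_mul_lt hA hε3
  obtain ⟨δ₀, hδ₀, hunif⟩ := Metric.uniformContinuous_iff.1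
    (hsupp.uniformContinuous_of_continuous hcont) η (by exact_mod_cast hη)
  filter_upwards [Ioo_mem_nhdsGT hδ₀] with δ hδ φ hφ
  have hcs := φ.hasCompactSupport_normed (μ := volume)
  have hfl : LocallyIntegrable (f - h) volume := (hf.sub hmem).locallyIntegrable hp
  have hhl : LocallyIntegrable h volume := hmem.locallyIntegrable hp
  have hsplit : (fun x => (φ.normed volume ⋆[lsmul ℝ ℝ, volume] f) x - f x) =
      (φ.normed volume ⋆[lsmul ℝ ℝ, volume] (f - h)) +
        ((fun x => (φ.normed volume ⋆[lsmul ℝ ℝ, volume] h) x - h x) + (h - f)) := by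
    have := (hcs.convolutionExists_left (lsmul ℝ ℝ) φ.continuous_normed hfl).distrib_add
      (hcs.convolutionExists_left (lsmul ℝ ℝ) φ.continuous_normed hhl)
    rw [sub_add_cancel] at this
    funext x
    simp only [this, Pi.add_apply, Pi.sub_apply]
    ring
  have hc1 : Continuous (φ.normed volume ⋆[lsmul ℝ ℝ, volume] (f - h)) :=
    hcs.continuous_convolution_left _ φ.continuous_normed hfl
  have hc2 : Continuous (φ.normed volume ⋆[lsmul ℝ ℝ, volume] h) :=
    hcs.continuous_convolution_left _ φ.continuous_normed hhl
  have hm3 : AEStronglyMeasurable (h - f) (volume.restrict K) :=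
    (hmem.1.sub hf.1).mono_measure Measure.restrict_le_self
  have h1 : eLpNorm (φ.normed volume ⋆[lsmul ℝ ℝ, volume] (f - h)) p (volume.restrict K)
      ≤ ε / 3 := (eLpNorm_mono_measure _ Measure.restrict_le_self).trans
    ((eLpNorm_normed_convolution_le φ hp hp' (hf.1.sub hmem.1)).trans hfh)
  have h2 : eLpNorm (fun x => (φ.normed volume ⋆[lsmul ℝ ℝ, volume] h) x - h x) p
      (volume.restrict K) ≤ ε / 3 := by
    refine (eLpNorm_le_of_ae_bound (C := η) (Filter.Eventually.of_forall fun x => ?_)).trans ?_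
    · rw [← dist_eq_norm]
      refine φ.dist_normed_convolution_le hmem.1 fun y hy => (hunif ?_).le
      rw [hφ] at hy
      exact (Metric.mem_ball.1 hy).trans hδ.2
    · rw [Measure.restrict_apply_univ, ENNReal.ofReal_coe_nnreal, mul_comm]
      exact hηA.le
  have h3 : eLpNorm (h - f) p (volume.restrict K) ≤ ε / 3 := by
    rw [eLpNorm_sub_comm]
    exact (eLpNorm_mono_measure _ Measure.restrict_le_self).trans hfh
  rw [hsplit]
  refine (eLpNorm_add_le hc1.aestronglyMeasurable
    ((hc2.sub hcont).aestronglyMeasurable.add hm3) hp).trans ?_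
  refine (add_le_add h1 ((eLpNorm_add_le (hc2.sub hcont).aestronglyMeasurable hm3 hp).trans
    (add_le_add h2 h3))).trans_eq ?_
  rw [← add_assoc, ENNReal.add_thirds]

end Mollification

/-- Mollification commutes with weak differentiation. -/
theorem fderiv_normed_convolution_indicator {n : ℕ} {U K : Set (EuclideanSpace ℝ (Fin n))}
    {i : Fin n} {u g : EuclideanSpace ℝ (Fin n) → ℝ} (h : IsWeakPartial U i u g)
    (hU : MeasurableSet U) (hKU : K ⊆ U) (hu : LocallyIntegrable (K.indicator u))
    (φ : ContDiffBump (0 : EuclideanSpace ℝ (Fin n))) {x : EuclideanSpace ℝ (Fin n)}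
    (hx : Metric.closedBall x φ.rOut ⊆ K) :
    fderiv ℝ (φ.normed volume ⋆[lsmul ℝ ℝ, volume] K.indicator u) x
      (EuclideanSpace.single i 1) = (φ.normed volume ⋆[lsmul ℝ ℝ, volume] K.indicator g) x := by
  have hcs := φ.hasCompactSupport_normed (μ := volume)
  have hcd : ContDiff ℝ ∞ (φ.normed volume) := φ.contDiff_normed
  have hcd1 : ContDiff ℝ 1 (φ.normed volume) := φ.contDiff_normed
  -- The reflected mollifier centred at `x` is an admissible test function. Its support lies in `K`,
  -- so the truncation of `u` and `g` to `K` is invisible to it.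
  set χ : EuclideanSpace ℝ (Fin n) → ℝ := fun y => φ.normed volume (x - y) with hχ
  have hχd : ContDiff ℝ ∞ χ := hcd.comp (contDiff_const.sub contDiff_id)
  have hχt : tsupport χ ⊆ Metric.closedBall x φ.rOut := by
    refine closure_minimal (fun y hy => ?_) Metric.isClosed_closedBall
    have : x - y ∈ Function.support (φ.normed volume) := hy
    rw [φ.support_normed_eq, mem_ball_zero_iff] at this
    rw [Metric.mem_closedBall', dist_eq_norm]
    exact this.le
  have hχcs : HasCompactSupport χ :=
    (isCompact_closedBall x φ.rOut).of_isClosed_subset (isClosed_tsupport χ) hχt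
  have hχf : ∀ y, fderiv ℝ χ y = - fderiv ℝ (φ.normed volume) (x - y) := fun y => by
    have h1 : HasFDerivAt (fun y => x - y)
        (-(ContinuousLinearMap.id ℝ (EuclideanSpace ℝ (Fin n)))) y :=
      (hasFDerivAt_id y).const_sub x
    have h2 := ((hcd1.differentiable one_ne_zero) (x - y)).hasFDerivAt.comp y h1
    rw [show χ = φ.normed volume ∘ fun y => x - y from rfl, h2.fderiv]
    ext v; simp
  have hweak := h.2.2 χ hχd hχcs (hχt.trans (hx.trans hKU))
  have hce : Integrable (fun t => (lsmul ℝ ℝ).precompL (EuclideanSpace ℝ (Fin n))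
      (fderiv ℝ (φ.normed volume) t) (K.indicator u (x - t))) volume :=
    (hcs.fderiv ℝ).convolutionExists_left _ (hcd1.continuous_fderiv one_ne_zero) hu x
  rw [(hcs.hasFDerivAt_convolution_left (lsmul ℝ ℝ) hcd1 hu x).fderiv, convolution_def,
    ContinuousLinearMap.integral_apply hce,
    convolution_eq_swap]
  rw [← integral_sub_left_eq_self _ volume x]
  simp only [ContinuousLinearMap.precompL_apply, ContinuousLinearMap.lsmul_apply, smul_eq_mul,
    sub_sub_cancel]
  have hu' : ∀ y, fderiv ℝ (φ.normed volume) (x - y) (EuclideanSpace.single i 1) * K.indicator u y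
      = U.indicator (fun y => - (u y * fderiv ℝ χ y (EuclideanSpace.single i 1))) y := by
    intro y
    by_cases hy : y ∈ K
    · rw [Set.indicator_of_mem hy, Set.indicator_of_mem (hKU hy), hχf]
      simp [mul_comm]
    · rw [Set.indicator_of_notMem hy, mul_zero]
      have h0 : fderiv ℝ χ y = 0 := by
        by_contra hne
        exact hy (hx (hχt (support_fderiv_subset ℝ hne)))
      exact (Set.indicator_apply_eq_zero.2 fun _ => by rw [h0]; simp).symm
  have hg' : ∀ y, φ.normed volume (x - y) * K.indicator g y =
      U.indicator (fun y => g y * χ y) y := by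
    intro y
    by_cases hy : y ∈ K
    · rw [Set.indicator_of_mem hy, Set.indicator_of_mem (hKU hy), mul_comm]
    · rw [Set.indicator_of_notMem hy, mul_zero]
      have h0 : χ y = 0 := by
        by_contra hne
        exact hy (hx (hχt (subset_tsupport _ hne)))
      exact (Set.indicator_apply_eq_zero.2 fun _ => by rw [h0]; simp).symm
  rw [integral_congr_ae (Filter.Eventually.of_forall hu'),
    integral_congr_ae (Filter.Eventually.of_forall hg')]
  rw [integral_indicator hU, integral_indicator hU, integral_neg, hweak, neg_neg]

/-- Continuous functions of class `W^{2,p}_loc` are approximated by smooth functions, uniformly on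
compact sets and with `L^p` convergence of the second derivatives. -/
theorem IsSobolevTwoLoc.exists_contDiff_approx {n : ℕ} {p : ℝ≥0∞} (hp : 1 ≤ p) (hp' : p ≠ ⊤)
    {U : Set (EuclideanSpace ℝ (Fin n))} (hU : IsOpen U) {u : EuclideanSpace ℝ (Fin n) → ℝ}
    {Du : EuclideanSpace ℝ (Fin n) → Fin n → ℝ}
    {D2u : EuclideanSpace ℝ (Fin n) → Matrix (Fin n) (Fin n) ℝ}
    (h : IsSobolevTwoLoc p U u Du D2u) (hu : ContinuousOn u U)
    {K : Set (EuclideanSpace ℝ (Fin n))} (hK : IsCompact K) (hKU : K ⊆ U) {ε : ℝ} (hε : 0 < ε) :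
    ∃ f : EuclideanSpace ℝ (Fin n) → ℝ, ContDiff ℝ 2 f ∧ (∀ x ∈ K, |f x - u x| ≤ ε) ∧
      ∀ i j, eLpNorm (fun x => hessian f x i j - D2u x i j) p (volume.restrict K) ≤
        ENNReal.ofReal ε := by
  -- Everything is cut off to an intermediate compact `L` to have global `L^p` functions; at small
  -- radii the mollification on `K` sees only values inside `L`.
  obtain ⟨L, hL, hKL, hLU⟩ := exists_compact_between hK hU hKU
  obtain ⟨δ₀, hδ₀, hδL⟩ := hK.exists_cthickening_subset_open isOpen_interior hKL
  obtain ⟨δ₁, hδ₁, hunif⟩ := Metric.uniformContinuousOn_iff.1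
    (hL.uniformContinuousOn_of_continuous (hu.mono hLU)) ε hε
  have hmem : ∀ {g : EuclideanSpace ℝ (Fin n) → ℝ}, MemLpLoc p U g → MemLp (L.indicator g) p :=
    fun hg => (memLp_indicator_iff_restrict hL.measurableSet).2 (hg L hL hLU)
  have hloc : ∀ {g : EuclideanSpace ℝ (Fin n) → ℝ}, MemLpLoc p U g →
      LocallyIntegrable (L.indicator g) := fun hg => (hmem hg).locallyIntegrable hp
  have hev : ∀ᶠ δ in 𝓝[>] (0 : ℝ), ∀ i j, ∀ φ : ContDiffBump (0 : EuclideanSpace ℝ (Fin n)),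
      φ.rOut = δ → eLpNorm (fun x => (φ.normed volume ⋆[lsmul ℝ ℝ, volume]
        L.indicator fun x => D2u x i j) x - L.indicator (fun x => D2u x i j) x) p
        (volume.restrict K) ≤ ENNReal.ofReal ε := by
    simp only [Filter.eventually_all]
    exact fun i j => eventually_eLpNorm_normed_convolution_sub_le hp hp'
      (hmem (h.memLpLoc_hess i j)) hK.measure_lt_top.ne (by simpa using hε)
  obtain ⟨δ, hδ, ⟨hδpos, hδ0⟩, -, hδ1⟩ := (hev.and
    ((Filter.Eventually.and (Ioo_mem_nhdsGT hδ₀) (Ioo_mem_nhdsGT hδ₁)))).exists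
  let φ : ContDiffBump (0 : EuclideanSpace ℝ (Fin n)) :=
    ⟨δ / 2, δ, half_pos hδpos, half_lt_self hδpos⟩
  have hcs := φ.hasCompactSupport_normed (μ := volume)
  have hball : ∀ x ∈ K, Metric.closedBall x δ₀ ⊆ L := fun x hx =>
    (Metric.closedBall_subset_cthickening hx δ₀).trans (hδL.trans interior_subset)
  have hnear : ∀ x ∈ K, ∀ᶠ z in 𝓝 x, Metric.closedBall z φ.rOut ⊆ L := by
    intro x hx
    filter_upwards [Metric.ball_mem_nhds x (sub_pos.2 hδ0)] with z hz
    refine (Metric.closedBall_subset_closedBall' ?_).trans (hball x hx)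
    have := Metric.mem_ball.1 hz
    change δ + dist z x ≤ δ₀
    linarith
  have hKL' : K ⊆ L := hKL.trans interior_subset
  refine ⟨φ.normed volume ⋆[lsmul ℝ ℝ, volume] L.indicator u,
    hcs.contDiff_convolution_left (n := 2) _ φ.contDiff_normed (hloc h.memLpLoc), ?_, ?_⟩
  · intro x hx
    have := φ.dist_normed_convolution_le (μ := volume) (x₀ := x) (ε := ε) (hmem h.memLpLoc).1 ?_
    · rwa [Set.indicator_of_mem (hKL' hx), Real.dist_eq] at this
    · intro z hz
      have hzδ : dist z x < δ := hz
      have hzL : z ∈ L := hball x hx (Metric.mem_closedBall.2 (hzδ.trans hδ0).le)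
      rw [Set.indicator_of_mem hzL, Set.indicator_of_mem (hKL' hx)]
      exact (hunif z hzL x (hKL' hx) (hzδ.trans hδ1)).le
  · intro i j
    refine (eLpNorm_congr_ae ?_).trans_le (hδ i j φ rfl)
    filter_upwards [ae_restrict_mem hK.measurableSet] with x hx
    rw [Set.indicator_of_mem (hKL' hx)]
    congr 1
    -- The identity for first derivatives is needed on a whole neighbourhood of `x`, since it is
    -- then differentiated once more.
    have hgrad : (fun z => fderiv ℝ (φ.normed volume ⋆[lsmul ℝ ℝ, volume] L.indicator u) z
        (EuclideanSpace.single i 1)) =ᶠ[𝓝 x]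
        (φ.normed volume ⋆[lsmul ℝ ℝ, volume] L.indicator fun z => Du z i) := by
      filter_upwards [hnear x hx] with z hz using fderiv_normed_convolution_indicator
        (h.weak_grad i) hU.measurableSet hLU (hloc h.memLpLoc) φ hz
    have hd : DifferentiableAt ℝ
        (fderiv ℝ (φ.normed volume ⋆[lsmul ℝ ℝ, volume] L.indicator u)) x := by
      have : ContDiff ℝ 2 (φ.normed volume ⋆[lsmul ℝ ℝ, volume] L.indicator u) :=
        hcs.contDiff_convolution_left (n := 2) _ φ.contDiff_normed (hloc h.memLpLoc)
      exact (this.fderiv_right (m := 1) (by norm_num)).differentiable one_ne_zero x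
    rw [← fderiv_normed_convolution_indicator (h.weak_hess i j) hU.measurableSet hLU
      (hloc (h.memLpLoc_grad i)) φ (hnear x hx).self_of_nhds, ← hgrad.fderiv_eq, hessian,
      fderiv_clm_apply hd (differentiableAt_const _)]
    simp

/-! ### Bony's maximum principle -/

theorem hessian_sub {n : ℕ} {f q : EuclideanSpace ℝ (Fin n) → ℝ} (hf : ContDiff ℝ 2 f)
    (hq : ContDiff ℝ 2 q) (x : EuclideanSpace ℝ (Fin n)) :
    hessian (fun x => f x - q x) x = hessian f x - hessian q x := by
  have h1 : fderiv ℝ (fun x => f x - q x) = fun x => fderiv ℝ f x - fderiv ℝ q x :=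
    funext fun x => fderiv_fun_sub ((hf.differentiable two_ne_zero) x)
      ((hq.differentiable two_ne_zero) x)
  have hd : ∀ {g : EuclideanSpace ℝ (Fin n) → ℝ}, ContDiff ℝ 2 g →
      DifferentiableAt ℝ (fderiv ℝ g) x := fun hg =>
    (hg.fderiv_right (m := 1) (by norm_num)).differentiable one_ne_zero x
  ext i j
  simp only [hessian, Matrix.sub_apply]
  rw [h1, fderiv_fun_sub (hd hf) (hd hq)]
  simp

theorem continuous_hessian {n : ℕ} {f : EuclideanSpace ℝ (Fin n) → ℝ} (hf : ContDiff ℝ 2 f)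
    (i j : Fin n) : Continuous fun x => hessian f x i j := by
  have hc : Continuous (fderiv ℝ (fderiv ℝ f)) :=
    (hf.fderiv_right (m := 1) (by norm_num)).continuous_fderiv one_ne_zero
  exact (hc.clm_apply continuous_const).clm_apply continuous_const

/-- Bony's maximum principle: in `W^{2,n}_loc`, a subsolution, relative to a `C²` function `q`,
has no strict maximum relative to `q` at the centre of a ball. -/
theorem exists_sphere_lt_of_subsolution {n : ℕ} (hn : 1 ≤ n) {lam Lam : ℝ} (hLam : 0 < Lam)
    {U : Set (EuclideanSpace ℝ (Fin n))} (hU : IsOpen U)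
    {a : EuclideanSpace ℝ (Fin n) → Matrix (Fin n) (Fin n) ℝ}
    (ha : IsUniformlyElliptic lam Lam U a) {u q : EuclideanSpace ℝ (Fin n) → ℝ}
    {Du : EuclideanSpace ℝ (Fin n) → Fin n → ℝ}
    {D2u : EuclideanSpace ℝ (Fin n) → Matrix (Fin n) (Fin n) ℝ}
    (h : IsSobolevTwoLoc n U u Du D2u) (hu : ContinuousOn u U) (hq : ContDiff ℝ 2 q)
    {y : EuclideanSpace ℝ (Fin n)} {s κ : ℝ} (hs : 0 < s) (hκ : 0 < κ)
    (hyU : Metric.closedBall y s ⊆ U)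
    (hsub : ∀ᵐ x ∂volume.restrict (Metric.ball y s),
      ∑ i, ∑ j, a x i j * hessian q x i j ≤ ∑ i, ∑ j, a x i j * D2u x i j) :
    ∃ x ∈ Metric.sphere y s, u y - q y < u x - q x + κ := by
  by_contra! hbd
  have hp : (1 : ℝ≥0∞) ≤ n := by exact_mod_cast hn
  have hnn : (n : ℝ≥0∞) ≠ 0 := (zero_lt_one.trans_le hp).ne'
  set c : ℝ := Lam / lam * (n * n) with hc
  have hlam := ha.lam_pos
  have hKcpt : IsCompact (Metric.closedBall y s) := isCompact_closedBall y s
  -- The approximation costs `ε` at `y` and `ε` on the sphere, so `ε ≤ κ/4` leaves a gap of at least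
  -- `κ/2 = δ s` with `δ = κ/(2s)`.
  have key : ∀ ε : ℝ, 0 < ε → ε ≤ κ / 4 →
      volume (Metric.ball (0 : EuclideanSpace ℝ (Fin n)) (κ / (2 * s))) ≤
        ENNReal.ofReal (c * ε) ^ n := by
    intro ε hε hεκ
    obtain ⟨f, hf, hfu, hfD⟩ := h.exists_contDiff_approx hp (ENNReal.natCast_ne_top n) hU hu
      hKcpt hyU hε
    set H : EuclideanSpace ℝ (Fin n) → ℝ :=
      fun x => ∑ i, ∑ j, ‖hessian f x i j - D2u x i j‖ with hH
    have hmeas : ∀ i j, AEStronglyMeasurable (fun x => hessian f x i j - D2u x i j)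
        (volume.restrict (Metric.closedBall y s)) := fun i j =>
      (continuous_hessian hf i j).aestronglyMeasurable.sub (h.memLpLoc_hess i j _ hKcpt hyU).1
    have hHnorm : eLpNorm H n (volume.restrict (Metric.closedBall y s)) ≤
        ENNReal.ofReal (n * n * ε) := by
      have h1 : H = ∑ i, ∑ j, fun x => ‖hessian f x i j - D2u x i j‖ := by
        ext x; simp [hH]
      rw [h1]
      refine (eLpNorm_sum_le (fun i _ => Finset.aestronglyMeasurable_sum _
        fun j _ => (hmeas i j).norm) hp).trans ?_
      calc _ ≤ ∑ _i : Fin n, ∑ _j : Fin n, ENNReal.ofReal ε := by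
            refine Finset.sum_le_sum fun i _ =>
              (eLpNorm_sum_le (fun j _ => (hmeas i j).norm) hp).trans ?_
            refine Finset.sum_le_sum fun j _ => ?_
            rw [eLpNorm_norm]
            exact hfD i j
        _ = _ := by
            rw [ENNReal.ofReal_mul (by positivity), ENNReal.ofReal_mul (by positivity)]
            simp [mul_assoc]
    have hv : ContDiff ℝ 2 fun x => f x - q x := hf.sub hq
    have hvbd : ∀ x ∈ Metric.sphere y s, f x - q x + κ / (2 * s) * s ≤ f y - q y := by
      intro x hx
      have h1 := abs_le.1 (hfu x (Metric.sphere_subset_closedBall hx))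
      have h2 := abs_le.1 (hfu y (Metric.mem_closedBall_self hs.le))
      have h3 := hbd x hx
      have h4 : κ / (2 * s) * s = κ / 2 := by field_simp
      linarith [h1.2, h2.1]
    have hsubset : concavitySet (fun x => f x - q x) y s ⊆ Metric.closedBall y s :=
      fun x hx => Metric.ball_subset_closedBall hx.1
    have hsubU : concavitySet (fun x => f x - q x) y s ⊆ U := hsubset.trans hyU
    have hmS := measurableSet_concavitySet hv y s
    calc volume (Metric.ball (0 : EuclideanSpace ℝ (Fin n)) (κ / (2 * s)))
        ≤ ∫⁻ z in concavitySet (fun x => f x - q x) y s,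
            ENNReal.ofReal |(hessian (fun x => f x - q x) z).det| :=
          volume_ball_le_lintegral_det_hessian hv hs hvbd
      _ ≤ ∫⁻ z in concavitySet (fun x => f x - q x) y s, ‖(Lam / lam) * H z‖ₑ ^ (n : ℝ) := by
          refine lintegral_mono_ae ?_
          filter_upwards [ae_restrict_mem hmS,
            ae_mono (Measure.restrict_mono hsubU le_rfl) ha.symm,
            ae_mono (Measure.restrict_mono hsubU le_rfl) ha.elliptic,
            ae_mono (Measure.restrict_mono (fun x hx => hx.1) le_rfl) hsub]
            with x hx hsymm hell hsubx
          have hH0 : 0 ≤ H x := Finset.sum_nonneg fun i _ => Finset.sum_nonneg fun j _ =>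
            norm_nonneg _
          have hab : ∀ i j, |a x i j| ≤ Lam := abs_apply_le_of_elliptic hsymm fun ξ =>
            ⟨(by positivity : (0 : ℝ) ≤ lam * ‖ξ‖ ^ 2).trans (hell ξ).1, (hell ξ).2⟩
          have hdet : |(hessian (fun x => f x - q x) x).det| ≤ (Lam * H x / lam) ^ n := by
            refine abs_det_le_of_elliptic hlam hsymm (fun ξ => (hell ξ).1) (hessian_isSymm hv x)
              (fun ξ => (sum_hessian _ x ξ).trans_le (hx.2 ξ)) ?_
            -- Split `a · D²(f - q)` into `a · (D²f - D²u)`, at least `-Lam * H x`, and `a · (D²u -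
            -- D²q)`, nonnegative by `hsub`.
            have h1 : -(Lam * H x) ≤ ∑ i, ∑ j, a x i j * (hessian f x i j - D2u x i j) := by
              rw [hH, Finset.mul_sum, ← Finset.sum_neg_distrib]
              refine Finset.sum_le_sum fun i _ => ?_
              rw [Finset.mul_sum, ← Finset.sum_neg_distrib]
              refine Finset.sum_le_sum fun j _ => ?_
              refine le_trans (neg_le_neg ?_) (neg_abs_le _)
              rw [abs_mul]
              exact mul_le_mul_of_nonneg_right (hab i j) (abs_nonneg _)
            rw [hessian_sub hf hq]
            simp only [Matrix.sub_apply, mul_sub, Finset.sum_sub_distrib] at h1 ⊢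
            linarith
          rw [ENNReal.rpow_natCast, ← enorm_pow, Real.enorm_of_nonneg (by positivity)]
          refine ENNReal.ofReal_le_ofReal (hdet.trans_eq ?_)
          rw [div_mul_eq_mul_div]
      _ ≤ ∫⁻ z in Metric.closedBall y s, ‖(Lam / lam) * H z‖ₑ ^ (n : ℝ) :=
          lintegral_mono_set hsubset
      _ = eLpNorm (fun z => (Lam / lam) * H z) n
            (volume.restrict (Metric.closedBall y s)) ^ n := by
          have := eLpNorm_nnreal_pow_eq_lintegral (μ := volume.restrict (Metric.closedBall y s))
            (f := fun z => (Lam / lam) * H z) (p := (n : NNReal)) (by exact_mod_cast hnn)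
          simpa using this.symm
      _ ≤ _ := by
          refine pow_le_pow_left' ?_ n
          have h1 : eLpNorm (fun z => (Lam / lam) * H z) n
              (volume.restrict (Metric.closedBall y s)) =
              ‖Lam / lam‖ₑ * eLpNorm H n (volume.restrict (Metric.closedBall y s)) :=
            eLpNorm_const_smul (Lam / lam) H n _
          rw [h1, Real.enorm_of_nonneg (by positivity), hc, mul_assoc,
            ENNReal.ofReal_mul (by positivity)]
          gcongr
  have htend : Filter.Tendsto (fun ε : ℝ => ENNReal.ofReal (c * ε) ^ n) (𝓝[>] 0) (𝓝 0) := by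
    have h1 : Filter.Tendsto (fun ε : ℝ => c * ε) (𝓝[>] 0) (𝓝 0) := by
      have : Continuous fun ε : ℝ => c * ε := by fun_prop
      simpa using (this.tendsto 0).mono_left nhdsWithin_le_nhds
    simpa [(Nat.one_le_iff_ne_zero.1 hn)] using ENNReal.Tendsto.pow (n := n) (ENNReal.tendsto_ofReal h1)
  -- Letting `ε → 0` forces a ball of fixed positive radius to have measure zero.
  have hle := ge_of_tendsto htend (Filter.mem_of_superset
    (Ioo_mem_nhdsGT (show (0 : ℝ) < κ / 4 by positivity)) fun ε hε => key ε hε.1 hε.2.le)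
  exact (Metric.measure_ball_pos volume (0 : EuclideanSpace ℝ (Fin n))
    (show 0 < κ / (2 * s) by positivity)).ne' (le_antisymm hle zero_le)

/-! ### Comparison with paraboloids and nondegeneracy -/

/-- The sum of two squared distances has a constant Hessian. -/
theorem hessian_add_dist_sq {n : ℕ} (c : ℝ) (b d x : EuclideanSpace ℝ (Fin n)) :
    hessian (fun x => c * ‖x - b‖ ^ 2 + c * ‖x - d‖ ^ 2) x =
      (4 * c) • (1 : Matrix (Fin n) (Fin n) ℝ) := by
  have hfd : fderiv ℝ (fun x => c * ‖x - b‖ ^ 2 + c * ‖x - d‖ ^ 2) =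
      fun x => (2 * c) • innerSL ℝ (x - b) + (2 * c) • innerSL ℝ (x - d) := by
    funext x
    have h1 : ∀ e : EuclideanSpace ℝ (Fin n),
        HasFDerivAt (fun x => c * ‖x - e‖ ^ 2) ((2 * c) • innerSL ℝ (x - e)) x := fun e => by
      refine (((hasFDerivAt_id x).sub_const e).norm_sq.const_mul c).congr_fderiv ?_
      ext v
      simp
      ring
    exact ((h1 b).add (h1 d)).fderiv
  have h2 : HasFDerivAt
      (fun x => (2 * c) • innerSL ℝ (x - b) + (2 * c) • innerSL ℝ (x - d))
      ((4 * c) • (innerSL ℝ : EuclideanSpace ℝ (Fin n) →L[ℝ] _)) x := by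
    have h3 : ∀ e : EuclideanSpace ℝ (Fin n), HasFDerivAt
        (fun x => (2 * c) • innerSL ℝ (x - e))
        ((2 * c) • (innerSL ℝ : EuclideanSpace ℝ (Fin n) →L[ℝ] _)) x := fun e =>
      ((innerSL ℝ : EuclideanSpace ℝ (Fin n) →L[ℝ] _).hasFDerivAt.comp x
        ((hasFDerivAt_id x).sub_const e)).const_smul (2 * c)
    refine ((h3 b).add (h3 d)).congr_fderiv ?_
    rw [← add_smul]
    congr 1
    ring
  ext i j
  rw [hessian, hfd, h2.fderiv]
  change 4 * c * inner ℝ (EuclideanSpace.single j (1 : ℝ)) (EuclideanSpace.single i (1 : ℝ)) =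
    4 * c * (1 : Matrix (Fin n) (Fin n) ℝ) i j
  rw [EuclideanSpace.inner_single_right, Matrix.one_apply]
  simp

end ObstacleProblem

theorem theorem4p1 (n : ℕ) (hn : 1 ≤ n) (Lam : ℝ) (hLam : 0 < Lam) :
    ∃ C : ℝ, 0 < C ∧
      ∀ (lam : ℝ) (a : EuclideanSpace ℝ (Fin n) → Matrix (Fin n) (Fin n) ℝ)
        (w : EuclideanSpace ℝ (Fin n) → ℝ),
        ObstacleProblem.IsUniformlyElliptic lam Lam (Metric.ball 0 1) a →
        ObstacleProblem.IsStrongSolution a w →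
        ∀ (x₀ : EuclideanSpace ℝ (Fin n)) (r : ℝ), 0 < r →
          Metric.ball x₀ r ⊆ Metric.ball 0 1 →
          x₀ ∈ closure (ObstacleProblem.positivitySet w) →
          ((C * r ^ 2 : ℝ) : EReal) ≤ ⨆ x ∈ Metric.ball x₀ r, (w x : EReal) := by
  have hn0 : (0 : ℝ) < n := by exact_mod_cast hn
  -- The sum of the two paraboloids has Hessian `4c I`, and `tr a ≤ n Lam`; this `c` makes `4c · n
  -- Lam = 1`, the right-hand side on `{w > 0}`.
  set c : ℝ := 1 / (4 * n * Lam) with hc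
  have hc0 : 0 < c := by positivity
  refine ⟨c / 4, by positivity, ?_⟩
  intro lam a w ha hw x₀ r hr hball hx₀
  obtain ⟨Dw, D2w, hsob, heq⟩ := hw.equation
  by_contra! hlt
  have hsmall : ∀ x ∈ Metric.ball x₀ r, w x < c / 4 * r ^ 2 := fun x hx => by
    have h1 : (w x : EReal) ≤ ⨆ x ∈ Metric.ball x₀ r, (w x : EReal) :=
      le_iSup₂ (f := fun x (_ : x ∈ Metric.ball x₀ r) => (w x : EReal)) x hx
    exact EReal.coe_lt_coe_iff.1 (h1.trans_lt hlt)
  obtain ⟨x₁, hx₁, hx₁d⟩ := Metric.mem_closure_iff.1 hx₀ (r / 2) (half_pos hr)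
  have hsub : Metric.closedBall x₁ (r / 2) ⊆ Metric.ball x₀ r :=
    Metric.closedBall_subset_ball' (by rw [dist_comm]; linarith)
  have hcont : ContinuousOn (fun x => w x - c * ‖x - x₁‖ ^ 2) (Metric.closedBall x₁ (r / 2)) :=
    (hw.continuousOn.mono (hsub.trans hball)).sub (by fun_prop)
  obtain ⟨y, hy, hymax⟩ := (isCompact_closedBall x₁ (r / 2)).exists_isMaxOn
    ⟨x₁, Metric.mem_closedBall_self (half_pos hr).le⟩ hcont
  have hy1 : w x₁ + c * ‖y - x₁‖ ^ 2 ≤ w y := by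
    have : w x₁ - c * ‖x₁ - x₁‖ ^ 2 ≤ w y - c * ‖y - x₁‖ ^ 2 :=
      hymax (Metric.mem_closedBall_self (half_pos hr).le)
    simp only [sub_self, norm_zero] at this
    linarith
  have hwx₁ : 0 < w x₁ := hx₁.2
  have hyw : 0 < w y := hwx₁.trans_le ((le_add_of_nonneg_right (by positivity)).trans hy1)
  have hyb : y ∈ Metric.ball x₁ (r / 2) := by
    rw [← Metric.ball_union_sphere] at hy
    -- On the sphere of radius `r/2`, `hy1` would give `w y > c (r/2)² = c/4 * r ^ 2`, against
    -- `hsmall`.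
    refine hy.resolve_right fun hsph => ?_
    rw [mem_sphere_iff_norm.1 hsph] at hy1
    have := hsmall y (hsub (Metric.sphere_subset_closedBall hsph))
    nlinarith
  have hopen : IsOpen (ObstacleProblem.positivitySet w) :=
    hw.continuousOn.isOpen_inter_preimage Metric.isOpen_ball isOpen_Ioi
  have hnhds : ObstacleProblem.positivitySet w ∩ Metric.ball x₁ (r / 2) ∈ nhds y :=
    (hopen.inter Metric.isOpen_ball).mem_nhds ⟨⟨hball (hsub hy), hyw⟩, hyb⟩
  obtain ⟨s, hs, hsy⟩ := Metric.nhds_basis_closedBall.mem_iff.1 hnhds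
  -- The second paraboloid, centred at `y`, vanishes there and equals `c s²` on the sphere of radius
  -- `s`, so the gap `κ = c * s ^ 2` is exactly the one that maximality of `y` provides.
  obtain ⟨x, hx, hxlt⟩ := ObstacleProblem.exists_sphere_lt_of_subsolution hn hLam Metric.isOpen_ball ha hsob
    hw.continuousOn (q := fun x => c * ‖x - x₁‖ ^ 2 + c * ‖x - y‖ ^ 2)
    ((contDiff_const.mul ((contDiff_id.sub contDiff_const).norm_sq ℝ)).add
      (contDiff_const.mul ((contDiff_id.sub contDiff_const).norm_sq ℝ))) hs
    (show 0 < c * s ^ 2 by positivity) (fun z hz => (hsy hz).1.1) (by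
      have hle : Metric.ball y s ⊆ Metric.ball 0 1 := fun z hz =>
        (hsy (Metric.ball_subset_closedBall hz)).1.1
      filter_upwards [ae_restrict_mem measurableSet_ball,
        ae_mono (Measure.restrict_mono hle le_rfl) ha.symm,
        ae_mono (Measure.restrict_mono hle le_rfl) ha.elliptic,
        ae_mono (Measure.restrict_mono hle le_rfl) heq] with z hz hsymm hell heqz
      rw [heqz, Set.indicator_of_mem (hsy (Metric.ball_subset_closedBall hz)).1]
      have hab : ∀ i j, |a z i j| ≤ Lam := ObstacleProblem.abs_apply_le_of_elliptic hsymm fun ξ =>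
        ⟨(mul_nonneg ha.lam_pos.le (by positivity)).trans (hell ξ).1, (hell ξ).2⟩
      simp only [ObstacleProblem.hessian_add_dist_sq, Matrix.smul_apply, Matrix.one_apply, smul_eq_mul, mul_ite,
        mul_one, mul_zero, Finset.sum_ite_eq, Finset.mem_univ, if_true]
      calc ∑ i, a z i i * (4 * c) ≤ ∑ _i : Fin n, Lam * (4 * c) :=
            Finset.sum_le_sum fun i _ =>
              mul_le_mul_of_nonneg_right ((le_abs_self _).trans (hab i i)) (by positivity)
        _ = 1 := by
            simp only [Finset.sum_const, Finset.card_univ, Fintype.card_fin, nsmul_eq_mul, hc]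
            field_simp)
  have hxm : w x - c * ‖x - x₁‖ ^ 2 ≤ w y - c * ‖y - x₁‖ ^ 2 :=
    hymax (Metric.ball_subset_closedBall (hsy (Metric.sphere_subset_closedBall hx)).2)
  rw [mem_sphere_iff_norm] at hx
  simp only [hx, sub_self, norm_zero] at hxlt
  linarith
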